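/- **Definitions.** A topological space $X$ is *Menger* if for each sequence $\mathcal U_1,\mathcal U_2,\dots$ of open covers of $X$ there are finite sets $\mathcal F_n\subseteq\mathcal U_n$ such that $\bigcup_n\mathcal F_n$ covers $X$; it is *Scheepers* if, for each such sequence, the finite sets $\mathcal F_n\subseteq\mathcal U_n$ can be chosen so that each finite subset of $X$ is contained in $\bigcup\mathcal F_n$ for some $n$. A *set of reals* is a topological space homeomorphic to a subspace of the real line. Let $[\mathbb N]^\infty$ be the family of infinite subsets of $\mathbb N$; for $a\in[\mathbb N]^\infty$ and $n\in\mathbb N$, let $a(n)$ be the $n$-th element of $a$ in increasing order. A family $D\subseteq[\mathbb N]^\infty$ is *dominating* if for each $x\in[\mathbb N]^\infty$ there is $y\in D$ such that $\{n: y(n)<x(n)\}$ is finite; $\mathfrak d$ is the minimal cardinality of a dominating family. A set $r\in[\mathbb N]^\infty$ *reaps* a family $A\subseteq[\mathbb N]^\infty$ if $a\cap r$ and $a\setminus r$ are infinite for all $a\in A$; $\mathfrak r$ is the minimal cardinality of a family $A\subseteq[\mathbb N]^\infty$ that no $r\in[\mathbb N]^\infty$ reaps. **Theorem.** Assume that $\mathfrak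 d\le\mathfrak r$. Then: 1. There is a Menger set of reals that is not Scheepers. 2. The Menger property is not productive, even for sets of reals: there are Menger sets of reals $X$ and $Y$ whose product space $X\times Y$ is not Menger. -/

import Mathlib

open Cardinal

/-- A space is Menger if, for every sequence of open covers `𝒰 n`, there are finite sets
`ℱ n ⊆ 𝒰 n` such that the union of all the families `ℱ n` covers the space. -/
def IsMenger (X : Type*) [TopologicalSpace X] : Prop :=
  ∀ 𝒰 : ℕ → Set (Set X), (∀ n, (∀ U ∈ 𝒰 n, IsOpen U) ∧ ⋃₀ 𝒰 n = Set.univ) →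
    ∃ ℱ : ℕ → Set (Set X), (∀ n, (ℱ n).Finite ∧ ℱ n ⊆ 𝒰 n) ∧ ⋃ n, ⋃₀ ℱ n = Set.univ

/-- A space is Scheepers if, for every sequence of open covers `𝒰 n`, there are finite sets
`ℱ n ⊆ 𝒰 n` such that every finite subset of the space is contained in `⋃₀ ℱ n` for
some `n`. -/
def IsScheepers (X : Type*) [TopologicalSpace X] : Prop :=
  ∀ 𝒰 : ℕ → Set (Set X), (∀ n, (∀ U ∈ 𝒰 n, IsOpen U) ∧ ⋃₀ 𝒰 n = Set.univ) →
    ∃ ℱ : ℕ → Set (Set X), (∀ n, (ℱ n).Finite ∧ ℱ n ⊆ 𝒰 n) ∧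
      ∀ F : Set X, F.Finite → ∃ n, F ⊆ ⋃₀ ℱ n

/-- A set of reals is a space homeomorphic to a subspace of the real line. -/
def IsSetOfReals (X : Type*) [TopologicalSpace X] : Prop :=
  ∃ S : Set ℝ, Nonempty (X ≃ₜ S)

/-- The family of infinite sets of natural numbers. -/
abbrev InfiniteSets : Type := {a : Set ℕ // a.Infinite}

/-- The increasing enumeration of an infinite set of natural numbers (indexed from `0`). -/
noncomputable def InfiniteSets.enum (a : InfiniteSets) (n : ℕ) : ℕ :=
  Nat.nth (fun k => k ∈ a.1) n

/-- `x` is dominated by `y`: the set of all `n` with `y(n) < x(n)` is finite. -/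
def InfiniteSets.DominatedBy (x y : InfiniteSets) : Prop :=
  {n : ℕ | y.enum n < x.enum n}.Finite

/-- A family of infinite sets is dominating if every infinite set is dominated by
a member of the family. -/
def IsDominatingFamily (D : Set InfiniteSets) : Prop :=
  ∀ x : InfiniteSets, ∃ y ∈ D, x.DominatedBy y

/-- The dominating number `𝔡`: the minimal cardinality of a dominating family. -/
noncomputable def dominatingNumber : Cardinal.{0} :=
  sInf {κ : Cardinal.{0} | ∃ D : Set InfiniteSets, IsDominatingFamily D ∧ #D = κ}

/-- The infinite set `r` reaps the family `A` if `a ∩ r` and `a \ r` are infinite for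
every `a ∈ A`. -/
def InfiniteSets.Reaps (r : InfiniteSets) (A : Set InfiniteSets) : Prop :=
  ∀ a ∈ A, (a.1 ∩ r.1).Infinite ∧ (a.1 \ r.1).Infinite

/-- The reaping number `𝔯`: the minimal cardinality of a family of infinite sets that
no infinite set reaps. -/
noncomputable def reapingNumber : Cardinal.{0} :=
  sInf {κ : Cardinal.{0} | ∃ A : Set InfiniteSets, (¬ ∃ r : InfiniteSets, r.Reaps A) ∧ #A = κ}

open Filter Set

/-! Let `Q` be the set of finite points of Cantor space and `d i`, for `i < 𝔡`, a dominating family.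
Points `x i`, `y i` are built so that for all `j ≤ i` each of them vanishes on `[n, d j n]` for
infinitely many `n`, yet for every `n` one of the two is constantly `true` on `[n, d i n]`
(`exists_avoiding_pair`). The vanishing makes `X = Q ∪ {x i}` and `Y = Q ∪ {y i}` `𝔡`-concentrated
on the countable set `Q`, hence Menger (`mengerOn_of_concentrated`, `exists_gap_bound`). The second
property defeats both conclusions with the covers `zeroIn n m`, `m ∈ ℕ`: given `f ≤* d i`, for
almost all `n` the points `x i`, `y i` do not both have a zero in `[n, f n]`. So `X × Y` is not
Menger, and the pairs `{x i, y i}` show that `X ∪ Y` is not Scheepers. -/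

/-! ### Cardinal invariants in terms of functions -/

/-- The infinite set that is the range of a strictly increasing function. -/
def rangeInfiniteSet (s : ℕ → ℕ) (hs : StrictMono s) : InfiniteSets :=
  ⟨Set.range s, Set.infinite_range_of_injective hs.injective⟩

theorem enum_strictMono (a : InfiniteSets) : StrictMono a.enum :=
  Nat.nth_strictMono a.2

theorem enum_rangeInfiniteSet (s : ℕ → ℕ) (hs : StrictMono s) :
    (rangeInfiniteSet s hs).enum = s := by
  refine (StrictMono.range_inj (enum_strictMono _) hs).1 ?_
  exact Nat.range_nth_of_infinite (p := fun k => k ∈ Set.range s) (rangeInfiniteSet s hs).2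

theorem exists_strictMono_ge (f : ℕ → ℕ) : ∃ s : ℕ → ℕ, StrictMono s ∧ ∀ n, f n ≤ s n := by
  refine ⟨fun n => n + ∑ i ∈ Finset.range (n + 1), f i, ?_, fun n => ?_⟩
  · refine strictMono_nat_of_lt_succ fun n => ?_
    rw [Finset.sum_range_succ _ (n + 1)]
    omega
  · simp only [Finset.sum_range_succ]
    omega

theorem isDominatingFamily_iff {D : Set InfiniteSets} :
    IsDominatingFamily D ↔ ∀ f : ℕ → ℕ, ∃ y ∈ D, ∀ᶠ n in atTop, f n ≤ y.enum n := by
  have key : ∀ x y : InfiniteSets,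
      x.DominatedBy y ↔ ∀ᶠ n in atTop, x.enum n ≤ y.enum n := by
    intro x y
    rw [← Nat.cofinite_eq_atTop, Filter.eventually_cofinite]
    simp only [not_le]
    rfl
  refine ⟨fun h f => ?_, fun h x => ?_⟩
  · obtain ⟨s, hs, hfs⟩ := exists_strictMono_ge f
    obtain ⟨y, hy, hxy⟩ := h (rangeInfiniteSet s hs)
    rw [key, enum_rangeInfiniteSet] at hxy
    exact ⟨y, hy, hxy.mono fun n hn => (hfs n).trans hn⟩
  · obtain ⟨y, hy, hxy⟩ := h x.enum
    exact ⟨y, hy, (key x y).2 hxy⟩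

theorem isDominatingFamily_univ : IsDominatingFamily Set.univ := fun x =>
  ⟨x, mem_univ x, by simp [InfiniteSets.DominatedBy]⟩

theorem exists_isDominatingFamily_mk_eq :
    ∃ D : Set InfiniteSets, IsDominatingFamily D ∧ #D = dominatingNumber :=
  csInf_mem (s := {κ : Cardinal.{0} | ∃ D : Set InfiniteSets, IsDominatingFamily D ∧ #D = κ})
    ⟨_, Set.univ, isDominatingFamily_univ, rfl⟩

theorem aleph0_le_dominatingNumber : ℵ₀ ≤ dominatingNumber := by
  obtain ⟨D, hD, hcard⟩ := exists_isDominatingFamily_mk_eq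
  rw [← hcard]
  by_contra! hlt
  have : Fintype D := (Cardinal.lt_aleph0_iff_fintype.1 hlt).some
  obtain ⟨y, hy, hev⟩ := isDominatingFamily_iff.1 hD fun n => (∑ z : D, z.1.enum n) + 1
  obtain ⟨n, hn⟩ := hev.exists
  have := Finset.single_le_sum (f := fun z : D => z.1.enum n) (fun _ _ => Nat.zero_le _)
    (Finset.mem_univ (⟨y, hy⟩ : D))
  simp only at this
  omega

theorem exists_frequently_gt_of_mk_lt {J : Type} (hJ : #J < dominatingNumber)
    (h : J → ℕ → ℕ) : ∃ g : ℕ → ℕ, ∀ j, ∃ᶠ n in atTop, h j n < g n := by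
  choose s hs hle using fun j => exists_strictMono_ge (h j)
  have hlt : #(Set.range fun j => rangeInfiniteSet (s j) (hs j)) < dominatingNumber :=
    Cardinal.mk_range_le.trans_lt hJ
  have hnot : ¬ IsDominatingFamily (Set.range fun j => rangeInfiniteSet (s j) (hs j)) :=
    fun hdom => notMem_of_lt_csInf' hlt ⟨_, hdom, rfl⟩
  rw [isDominatingFamily_iff] at hnot
  push Not at hnot
  obtain ⟨g, hg⟩ := hnot
  refine ⟨g, fun j => ?_⟩
  have := hg _ ⟨j, rfl⟩
  rw [enum_rangeInfiniteSet] at this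
  exact this.mono fun n hn => (hle j n).trans_lt hn

theorem exists_reaping_of_mk_lt {J : Type} (hJ : #J < reapingNumber) (A : J → Set ℕ)
    (hA : ∀ j, (A j).Infinite) :
    ∃ r : Set ℕ, ∀ j, (A j ∩ r).Infinite ∧ (A j \ r).Infinite := by
  have hlt : #(Set.range fun j => (⟨A j, hA j⟩ : InfiniteSets)) < reapingNumber :=
    Cardinal.mk_range_le.trans_lt hJ
  by_contra hcon
  refine notMem_of_lt_csInf' hlt ⟨_, ?_, rfl⟩
  rintro ⟨r, hr⟩
  exact hcon ⟨r.1, fun j => hr _ ⟨j, rfl⟩⟩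

/-- A dominating family of strictly increasing functions, indexed by a linear order whose
closed initial segments are smaller than `𝔡`. -/
theorem exists_dominating_enumeration :
    ∃ d : dominatingNumber.ord.ToType → ℕ → ℕ, (∀ i, StrictMono (d i)) ∧
      ∀ f : ℕ → ℕ, ∃ i, ∀ᶠ n in atTop, f n ≤ d i n := by
  obtain ⟨D, hD, hcard⟩ := exists_isDominatingFamily_mk_eq
  have : #dominatingNumber.ord.ToType = #D := by rw [hcard, Cardinal.mk_ord_toType]
  obtain ⟨e⟩ := Cardinal.eq.1 this
  refine ⟨fun i => (e i).1.enum, fun i => enum_strictMono _, fun f => ?_⟩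
  obtain ⟨y, hy, h⟩ := isDominatingFamily_iff.1 hD f
  exact ⟨e.symm ⟨y, hy⟩, by simpa using h⟩

/-- Closed segments are needed because the case `j = i` yields the infinitely many zeros of `x i`
and `y i`. -/
theorem mk_Iic_lt_dominatingNumber (i : dominatingNumber.ord.ToType) :
    #(Set.Iic i) < dominatingNumber := by
  rw [← Set.Iio_insert]
  exact Cardinal.mk_insert_le.trans_lt
    (Cardinal.add_lt_of_lt aleph0_le_dominatingNumber (by
      simpa using Cardinal.mk_Iio_lt i (by simp))
      (Cardinal.one_lt_aleph0.trans_le aleph0_le_dominatingNumber))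

/-! ### The combinatorial construction -/

/-- Left end points of consecutive blocks `[p k, max (g k) (p k)]`, where each block ends
well before the next one begins as measured by `D`. -/
def blockStart (D g : ℕ → ℕ) : ℕ → ℕ
  | 0 => 0
  | k + 1 => D (max (g k) (blockStart D g k)) + 1

/-- Right end points of the blocks starting at `blockStart D g k`. -/
def blockEnd (D g : ℕ → ℕ) (k : ℕ) : ℕ := max (g k) (blockStart D g k)

theorem blockStart_succ (D g : ℕ → ℕ) (k : ℕ) :
    blockStart D g (k + 1) = D (blockEnd D g k) + 1 := rfl

theorem blockStart_le_blockEnd (D g : ℕ → ℕ) (k : ℕ) : blockStart D g k ≤ blockEnd D g k :=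
  le_max_right _ _

theorem blockStart_strictMono {D : ℕ → ℕ} (hD : StrictMono D) (g : ℕ → ℕ) :
    StrictMono (blockStart D g) :=
  strictMono_nat_of_lt_succ fun k => by
    have := hD.le_apply (x := blockEnd D g k)
    have := blockStart_le_blockEnd D g k
    rw [blockStart_succ]
    omega

/-- If the blocks were short from index `K` on, their starts would grow at most like iterates of `n
↦ D (d n) + 1`, contradicting the size of `g`. Iterating `k + 1` times from `k` absorbs the unknown
`K` and `blockStart D g K` once `k` exceeds both, so one bound serves every `K`. -/
theorem infinite_blocks {D d g : ℕ → ℕ} (hD : StrictMono D) (hd : StrictMono d)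
    (hg : ∃ᶠ k in atTop, (fun n => D (d n) + 1)^[k + 1] k < g k) :
    {k | d (blockStart D g k) ≤ blockEnd D g k}.Infinite := by
  rw [← Nat.frequently_atTop_iff_infinite]
  by_contra hcon
  rw [not_frequently, eventually_atTop] at hcon
  obtain ⟨K, hK⟩ := hcon
  set H : ℕ → ℕ := fun n => D (d n) + 1 with hH
  have Hmono : Monotone H := fun a b hab =>
    Nat.succ_le_succ (hD.monotone (hd.monotone hab))
  have Hle : ∀ n, n ≤ H n := fun n =>
    (hd.le_apply.trans hD.le_apply).trans (Nat.le_succ _)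
  have bound : ∀ i, blockStart D g (K + i) ≤ H^[i] (blockStart D g K) := by
    intro i
    induction i with
    | zero => simp
    | succ i ih =>
      rw [← add_assoc, blockStart_succ, Function.iterate_succ_apply']
      refine le_trans (Nat.succ_le_succ ?_) (Hmono ih)
      exact hD.monotone (not_le.1 (hK (K + i) (by omega))).le
  obtain ⟨k, hk, hlt⟩ := (frequently_atTop.1 hg) (max K (blockStart D g K))
  have hKk : K ≤ k := (le_max_left _ _).trans hk
  have hpk : blockStart D g K ≤ k := (le_max_right _ _).trans hk
  have h1 : g k ≤ blockStart D g (k + 1) := by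
    rw [blockStart_succ]
    exact ((le_max_left _ _).trans hD.le_apply).trans (Nat.le_succ _)
  have h2 : blockStart D g (k + 1) ≤ H^[k + 1 - K] (blockStart D g K) := by
    have := bound (k + 1 - K)
    rwa [show K + (k + 1 - K) = k + 1 by omega] at this
  have h3 : H^[k + 1 - K] (blockStart D g K) ≤ H^[k + 1 - K] k := Hmono.iterate _ hpk
  have h4 : H^[k + 1 - K] k ≤ H^[k + 1] k :=
    Function.monotone_iterate_of_id_le (f := H) (fun n => Hle n) (by omega : k + 1 - K ≤ k + 1) k
  omega

/-- The point of Cantor space that vanishes exactly on the blocks with index in `r`. -/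
noncomputable def blockAvoiding (D g : ℕ → ℕ) (r : Set ℕ) : ℕ → Bool := fun n =>
  open Classical in !decide (∃ k ∈ r, blockStart D g k ≤ n ∧ n ≤ blockEnd D g k)

theorem blockAvoiding_eq_false_iff {D g : ℕ → ℕ} {r : Set ℕ} {n : ℕ} :
    blockAvoiding D g r n = false ↔ ∃ k ∈ r, blockStart D g k ≤ n ∧ n ≤ blockEnd D g k := by
  simp [blockAvoiding]

theorem frequently_blockAvoiding {D d g : ℕ → ℕ} (hD : StrictMono D) {r : Set ℕ}
    (hr : ({k | d (blockStart D g k) ≤ blockEnd D g k} ∩ r).Infinite) :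
    ∃ᶠ n in atTop, ∀ l ∈ Set.Icc n (d n), blockAvoiding D g r l = false := by
  rw [frequently_atTop]
  intro N
  obtain ⟨k, ⟨hk, hkr⟩, hNk⟩ := hr.exists_gt N
  refine ⟨blockStart D g k, hNk.le.trans (blockStart_strictMono hD g).le_apply, fun l hl => ?_⟩
  exact blockAvoiding_eq_false_iff.2 ⟨k, hkr, hl.1, hl.2.trans hk⟩

/-- The gaps between blocks are too long for `[n, D n]` to meet two of them, and a single block has
its index in only one of `r`, `rᶜ`. -/
theorem blockAvoiding_or {D : ℕ → ℕ} (hD : StrictMono D) (g : ℕ → ℕ) (r : Set ℕ) (n : ℕ) :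
    (∀ l ∈ Set.Icc n (D n), blockAvoiding D g r l = true) ∨
      ∀ l ∈ Set.Icc n (D n), blockAvoiding D g rᶜ l = true := by
  by_contra! hcon
  simp only [ne_eq, Bool.not_eq_true, blockAvoiding_eq_false_iff] at hcon
  obtain ⟨⟨a, ha, k, hk, hka, hak⟩, b, hb, m, hm, hmb, hbm⟩ := hcon
  have sep : ∀ {k m a b : ℕ}, k < m → n ≤ a → a ≤ blockEnd D g k → blockStart D g m ≤ b →
      b ≤ D n → False := by
    intro k m a b hkm hna hak hmb hbD
    have h1 := (blockStart_strictMono hD g).monotone (Nat.succ_le_of_lt hkm)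
    rw [Nat.succ_eq_add_one, blockStart_succ] at h1
    have h2 := hD.monotone (hna.trans hak)
    omega
  rcases lt_trichotomy k m with hkm | rfl | hmk
  · exact sep hkm ha.1 hak hmb hb.2
  · exact hm hk
  · exact sep hmk hb.1 hbm hka ha.2

theorem exists_avoiding_pair (h : dominatingNumber ≤ reapingNumber) {J : Type}
    (hJ : #J < dominatingNumber) {d : J → ℕ → ℕ} (hd : ∀ j, StrictMono (d j))
    {D : ℕ → ℕ} (hD : StrictMono D) :
    ∃ x y : ℕ → Bool,
      (∀ j, ∃ᶠ n in atTop, ∀ l ∈ Set.Icc n (d j n), x l = false) ∧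
      (∀ j, ∃ᶠ n in atTop, ∀ l ∈ Set.Icc n (d j n), y l = false) ∧
      ∀ n, (∀ l ∈ Set.Icc n (D n), x l = true) ∨ ∀ l ∈ Set.Icc n (D n), y l = true := by
  -- Fewer than `𝔡` requirements give one `g` with long blocks for every `d j`; as `𝔡 ≤ 𝔯`, one `r`
  -- then splits all these sets of indices.
  obtain ⟨g, hg⟩ := exists_frequently_gt_of_mk_lt hJ
    fun j k => (fun n => D (d j n) + 1)^[k + 1] k
  obtain ⟨r, hr⟩ := exists_reaping_of_mk_lt (hJ.trans_le h) _
    fun j => infinite_blocks hD (hd j) (hg j)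
  exact ⟨blockAvoiding D g r, blockAvoiding D g rᶜ,
    fun j => frequently_blockAvoiding hD (hr j).1,
    fun j => frequently_blockAvoiding hD (hr j).2, blockAvoiding_or hD g r⟩

/-! ### Menger subsets of a space -/

/-- The Menger property of a subset, phrased with families of open sets of the ambient space. -/
def MengerOn {T : Type*} [TopologicalSpace T] (S : Set T) : Prop :=
  ∀ 𝒰 : ℕ → Set (Set T), (∀ n, (∀ U ∈ 𝒰 n, IsOpen U) ∧ S ⊆ ⋃₀ 𝒰 n) →
    ∃ ℱ : ℕ → Set (Set T), (∀ n, (ℱ n).Finite ∧ ℱ n ⊆ 𝒰 n) ∧ S ⊆ ⋃ n, ⋃₀ ℱ n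

theorem MengerOn.isMenger {T : Type*} [TopologicalSpace T] {S : Set T} (hS : MengerOn S) :
    IsMenger S := by
  intro 𝒰 h𝒰
  obtain ⟨ℱ, hℱ, hcov⟩ := hS (fun n => {V | IsOpen V ∧ ((↑) : S → T) ⁻¹' V ∈ 𝒰 n})
    fun n => ⟨fun U hU => hU.1, fun s hs => by
      have : (⟨s, hs⟩ : S) ∈ ⋃₀ 𝒰 n := (h𝒰 n).2 ▸ mem_univ _
      obtain ⟨U, hU, hsU⟩ := this
      obtain ⟨V, hV, rfl⟩ := isOpen_induced_iff.1 ((h𝒰 n).1 U hU)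
      exact ⟨V, ⟨hV, hU⟩, hsU⟩⟩
  refine ⟨fun n => (fun V => ((↑) : S → T) ⁻¹' V) '' ℱ n, fun n => ⟨(hℱ n).1.image _, ?_⟩, ?_⟩
  · rintro _ ⟨V, hV, rfl⟩
    exact ((hℱ n).2 hV).2
  · refine eq_univ_of_forall fun s => ?_
    obtain ⟨n, V, hV, hsV⟩ := by simpa only [mem_iUnion] using hcov s.2
    exact mem_iUnion.2 ⟨n, _, mem_image_of_mem _ hV, hsV⟩

theorem MengerOn.union {T : Type*} [TopologicalSpace T] {S R : Set T} (hS : MengerOn S)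
    (hR : MengerOn R) : MengerOn (S ∪ R) := by
  intro 𝒰 h𝒰
  obtain ⟨ℱ, hℱ, hcov⟩ := hS 𝒰 fun n => ⟨(h𝒰 n).1, subset_union_left.trans (h𝒰 n).2⟩
  obtain ⟨𝒢, h𝒢, hcov'⟩ := hR 𝒰 fun n => ⟨(h𝒰 n).1, subset_union_right.trans (h𝒰 n).2⟩
  refine ⟨fun n => ℱ n ∪ 𝒢 n,
    fun n => ⟨(hℱ n).1.union (h𝒢 n).1, union_subset (hℱ n).2 (h𝒢 n).2⟩, union_subset ?_ ?_⟩
  · exact hcov.trans (iUnion_mono fun n => sUnion_subset_sUnion subset_union_left)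
  · exact hcov'.trans (iUnion_mono fun n => sUnion_subset_sUnion subset_union_right)

/-- Each point codes a function: the index, in a countable subcover of the `n`-th cover, of a set
containing it. A `g` not dominated by these functions bounds the finite selections. -/
theorem mengerOn_of_mk_lt {T : Type} [TopologicalSpace T] [SecondCountableTopology T] {S : Set T}
    (hS : #S < dominatingNumber) : MengerOn S := by
  intro 𝒰 h𝒰
  choose 𝒱 hc hsub heq using fun n => TopologicalSpace.isOpen_sUnion_countable (𝒰 n) (h𝒰 n).1
  choose e he using fun n => Set.countable_iff_exists_injOn.1 (hc n)
  have hmem : ∀ s : S, ∀ n, ∃ V ∈ 𝒱 n, s.1 ∈ V := fun s n => by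
    have := (h𝒰 n).2 s.2
    rwa [← heq n] at this
  choose V hV hsV using hmem
  obtain ⟨g, hg⟩ := exists_frequently_gt_of_mk_lt hS fun s n => e n (V s n)
  refine ⟨fun n => {W ∈ 𝒱 n | e n W < g n}, fun n => ⟨?_, fun W hW => hsub n hW.1⟩, fun s hs => ?_⟩
  · exact Set.Finite.of_finite_image ((Set.finite_lt_nat (g n)).subset (by
      rintro _ ⟨W, hW, rfl⟩
      exact hW.2)) ((he n).mono fun W hW => hW.1)
  · obtain ⟨n, hn⟩ := (hg ⟨s, hs⟩).exists
    exact mem_iUnion.2 ⟨n, _, ⟨hV ⟨s, hs⟩ n, hn⟩, hsV ⟨s, hs⟩ n⟩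

/-- A set that is `𝔡`-concentrated on a countable subset is Menger. -/
theorem mengerOn_of_concentrated {T : Type} [TopologicalSpace T] [SecondCountableTopology T]
    {Q S : Set T} (hQ : Q.Countable)
    (h : ∀ U, IsOpen U → Q ⊆ U → #(S \ U : Set T) < dominatingNumber) : MengerOn (Q ∪ S) := by
  intro 𝒰 h𝒰
  obtain ⟨e, he⟩ := Set.countable_iff_exists_injOn.1 hQ
  -- The `n`-th cover takes care of the point of `Q` numbered `n`, if any; the fewer than `𝔡` points
  -- of `S` left over are covered by a second selection from the same covers.
  have hmem : ∀ n, ∃ ℱ : Set (Set T), ℱ.Finite ∧ ℱ ⊆ 𝒰 n ∧ ∀ q ∈ Q, e q = n → q ∈ ⋃₀ ℱ := by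
    intro n
    by_cases hn : ∃ q ∈ Q, e q = n
    · obtain ⟨q, hq, hqn⟩ := hn
      obtain ⟨U, hU, hqU⟩ := (h𝒰 n).2 (Or.inl hq)
      refine ⟨{U}, finite_singleton U, by simpa using hU, fun q' hq' hqn' => ?_⟩
      rw [he hq' hq (hqn'.trans hqn.symm)]
      simpa using hqU
    · exact ⟨∅, finite_empty, empty_subset _, fun q hq hqn => (hn ⟨q, hq, hqn⟩).elim⟩
  choose ℱ hfin hsub hcov using hmem
  have hopen : IsOpen (⋃ n, ⋃₀ ℱ n) :=
    isOpen_iUnion fun n => isOpen_sUnion fun U hU => (h𝒰 n).1 U (hsub n hU)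
  obtain ⟨𝒢, h𝒢, hcov'⟩ := mengerOn_of_mk_lt
    (h _ hopen fun q hq => mem_iUnion.2 ⟨e q, hcov _ q hq rfl⟩) 𝒰 fun n =>
      ⟨(h𝒰 n).1, (sdiff_subset.trans subset_union_right).trans (h𝒰 n).2⟩
  refine ⟨fun n => ℱ n ∪ 𝒢 n,
    fun n => ⟨(hfin n).union (h𝒢 n).1, union_subset (hsub n) (h𝒢 n).2⟩, fun s hs => ?_⟩
  have hs' : s ∈ (⋃ n, ⋃₀ ℱ n) ∪ ⋃ n, ⋃₀ 𝒢 n := by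
    by_cases hsU : s ∈ ⋃ n, ⋃₀ ℱ n
    · exact Or.inl hsU
    · rcases hs with hs | hs
      · exact Or.inl (mem_iUnion.2 ⟨e s, hcov _ s hs rfl⟩)
      · exact Or.inr (hcov' ⟨hs, hsU⟩)
  simpa only [sUnion_union, iUnion_union_distrib] using hs'

theorem isSetOfReals_coe (S : Set (ℕ → Bool)) : IsSetOfReals S := by
  have he : Topology.IsEmbedding
      (((↑) : cantorSet → ℝ) ∘ cantorSetHomeomorphNatToBool.symm ∘ ((↑) : S → ℕ → Bool)) :=
    Topology.IsEmbedding.subtypeVal.comp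
      (cantorSetHomeomorphNatToBool.symm.isEmbedding.comp Topology.IsEmbedding.subtypeVal)
  exact ⟨_, ⟨he.toHomeomorph⟩⟩

/-! ### Increasing covers -/

theorem exists_nat_sUnion_subset {X : Type*} {W : ℕ → Set X} (hmono : Monotone W)
    {ℱ : Set (Set X)} (hfin : ℱ.Finite) (hsub : ℱ ⊆ Set.range W) : ∃ b, ⋃₀ ℱ ⊆ W b := by
  choose! m hm using hsub
  obtain ⟨b, hb⟩ := (hfin.image m).bddAbove
  refine ⟨b, sUnion_subset fun U hU => ?_⟩
  rw [← hm hU]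
  exact hmono (hb (mem_image_of_mem m hU))

theorem IsMenger.exists_frequently_mem {X : Type*} [TopologicalSpace X] (hX : IsMenger X)
    {W : ℕ → ℕ → Set X} (hopen : ∀ n m, IsOpen (W n m)) (hmono : ∀ n, Monotone (W n))
    (hcov : ∀ n x, ∃ m, x ∈ W n m) : ∃ f : ℕ → ℕ, ∀ x, ∃ᶠ n in atTop, x ∈ W n (f n) := by
  have step : ∀ i, ∃ b : ℕ → ℕ, ∀ x, ∃ n, x ∈ W (n + i) (b n) := by
    intro i
    obtain ⟨ℱ, hℱ, hun⟩ := hX (fun n => Set.range (W (n + i))) fun n =>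
      ⟨by rintro _ ⟨m, rfl⟩; exact hopen _ m,
        eq_univ_of_forall fun x => by simpa using hcov (n + i) x⟩
    choose b hb using fun n => exists_nat_sUnion_subset (hmono (n + i)) (hℱ n).1 (hℱ n).2
    refine ⟨b, fun x => ?_⟩
    obtain ⟨n, hn⟩ := mem_iUnion.1 (hun ▸ mem_univ x : x ∈ ⋃ n, ⋃₀ ℱ n)
    exact ⟨n, hb n hn⟩
  choose b hb using step
  -- Each tail of the sequence of covers catches every point once; the supremum over the tails
  -- starting at `i ≤ n` makes this happen infinitely often.
  refine ⟨fun n => (Finset.range (n + 1)).sup fun i => b i (n - i), fun x => ?_⟩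
  rw [frequently_atTop]
  intro i
  obtain ⟨n, hn⟩ := hb i x
  refine ⟨n + i, by omega, hmono _ ?_ hn⟩
  simpa using Finset.le_sup (f := fun j => b j (n + i - j))
    (Finset.mem_range.2 (by omega : i < n + i + 1))

theorem IsScheepers.exists_frequently_subset {X : Type*} [TopologicalSpace X] (hX : IsScheepers X)
    {W : ℕ → ℕ → Set X} (hopen : ∀ n m, IsOpen (W n m)) (hmono : ∀ n, Monotone (W n))
    (hcov : ∀ n x, ∃ m, x ∈ W n m) :
    ∃ f : ℕ → ℕ, ∀ F : Set X, F.Finite → ∃ᶠ n in atTop, F ⊆ W n (f n) := by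
  have step : ∀ i, ∃ b : ℕ → ℕ, ∀ F : Set X, F.Finite → ∃ n, F ⊆ W (n + i) (b n) := by
    intro i
    obtain ⟨ℱ, hℱ, hun⟩ := hX (fun n => Set.range (W (n + i))) fun n =>
      ⟨by rintro _ ⟨m, rfl⟩; exact hopen _ m,
        eq_univ_of_forall fun x => by simpa using hcov (n + i) x⟩
    choose b hb using fun n => exists_nat_sUnion_subset (hmono (n + i)) (hℱ n).1 (hℱ n).2
    refine ⟨b, fun F hF => ?_⟩
    obtain ⟨n, hn⟩ := hun F hF
    exact ⟨n, hn.trans (hb n)⟩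
  choose b hb using step
  refine ⟨fun n => (Finset.range (n + 1)).sup fun i => b i (n - i), fun F hF => ?_⟩
  rw [frequently_atTop]
  intro i
  obtain ⟨n, hn⟩ := hb i F hF
  refine ⟨n + i, by omega, hn.trans (hmono _ ?_)⟩
  simpa using Finset.le_sup (f := fun j => b j (n + i - j))
    (Finset.mem_range.2 (by omega : i < n + i + 1))

/-! ### Sets concentrated on the finite sets -/

/-- The points of Cantor space that are characteristic functions of finite sets. -/
def finitePoints : Set (ℕ → Bool) := {z | {n | z n = true}.Finite}

theorem countable_finitePoints : finitePoints.Countable := by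
  refine Set.Countable.mono ?_
    (Set.countable_range fun s : Finset ℕ => fun n => decide (n ∈ s))
  intro z hz
  have hz' : {n | z n = true}.Finite := hz
  refine ⟨hz'.toFinset, ?_⟩
  funext n
  simp

theorem frequently_false_of_mem_finitePoints {z : ℕ → Bool} (hz : z ∈ finitePoints) :
    ∃ᶠ n in atTop, z n = false := by
  rw [Nat.frequently_atTop_iff_infinite]
  have := Set.Finite.infinite_compl (show {n | z n = true}.Finite from hz)
  convert this using 1
  ext n
  simp

/-- A compact set of infinite sets has a bound on the gaps between members. -/
theorem exists_gap_bound {U : Set (ℕ → Bool)} (hU : IsOpen U) (hfin : finitePoints ⊆ U) :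
    ∃ f : ℕ → ℕ, ∀ z ∉ U, ∀ n, ∃ l ∈ Set.Icc n (f n), z l = true := by
  have key : ∀ n, ∃ m, ∀ z ∉ U, ∃ l ∈ Set.Icc n m, z l = true := by
    intro n
    -- A point outside `U` is not finite, so it takes the value `true` somewhere beyond `n`;
    -- compactness makes the bound uniform.
    obtain ⟨m, hm⟩ := (hU.isClosed_compl.isCompact).elim_directed_cover
      (fun m => {z : ℕ → Bool | ∃ l ∈ Set.Icc n m, z l = true})
      (fun m => by
        have : {z : ℕ → Bool | ∃ l ∈ Set.Icc n m, z l = true}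
            = ⋃ l ∈ Set.Icc n m, (fun z : ℕ → Bool => z l) ⁻¹' {true} := by
          ext z; simp
        rw [this]
        exact isOpen_biUnion fun l _ => (isOpen_discrete _).preimage (continuous_apply l))
      (fun z hz => by
        by_contra hcon
        refine hz (hfin ((Set.finite_lt_nat n).subset fun l hl => ?_))
        by_contra hnl
        exact hcon (mem_iUnion.2 ⟨l, l, ⟨not_lt.1 hnl, le_rfl⟩, hl⟩))
      (Monotone.directed_le fun a b hab z hz => by
        obtain ⟨l, hl, hzl⟩ := hz
        exact ⟨l, ⟨hl.1, hl.2.trans hab⟩, hzl⟩)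
    exact ⟨m, fun z hz => hm hz⟩
  choose f hf using key
  exact ⟨f, fun z hz n => hf n z hz⟩

theorem mengerOn_finitePoints_union_range {d : dominatingNumber.ord.ToType → ℕ → ℕ}
    (hdom : ∀ f : ℕ → ℕ, ∃ i, ∀ᶠ n in atTop, f n ≤ d i n)
    {x : dominatingNumber.ord.ToType → ℕ → Bool}
    (hx : ∀ i, ∀ j ≤ i, ∃ᶠ n in atTop, ∀ l ∈ Set.Icc n (d j n), x i l = false) :
    MengerOn (finitePoints ∪ Set.range x) := by
  refine mengerOn_of_concentrated countable_finitePoints fun U hU hfin => ?_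
  obtain ⟨f, hf⟩ := exists_gap_bound hU hfin
  obtain ⟨j, hj⟩ := hdom f
  refine lt_of_le_of_lt
    ((Cardinal.mk_le_mk_of_subset (t := x '' Set.Iic j) ?_).trans Cardinal.mk_image_le)
    (mk_Iic_lt_dominatingNumber j)
  rintro _ ⟨⟨i, rfl⟩, hi⟩
  refine mem_image_of_mem x ?_
  -- For `i > j`, `x i` vanishes on some `[n, d j n] ⊇ [n, f n]`, which the gap bound `f` forbids
  -- outside `U`.
  by_contra hij
  obtain ⟨n, hn, hle⟩ := ((hx i j (not_le.1 hij).le).and_eventually hj).exists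
  obtain ⟨l, hl, htrue⟩ := hf _ hi n
  simp [hn l ⟨hl.1, hl.2.trans hle⟩] at htrue

/-- The points of Cantor space with a zero in `[n, m]`. -/
def zeroIn (n m : ℕ) : Set (ℕ → Bool) := {z | ∃ l ∈ Set.Icc n m, z l = false}

theorem isOpen_zeroIn (n m : ℕ) : IsOpen (zeroIn n m) := by
  have : zeroIn n m = ⋃ l ∈ Set.Icc n m, (fun z : ℕ → Bool => z l) ⁻¹' {false} := by
    ext z; simp [zeroIn]
  rw [this]
  exact isOpen_biUnion fun l _ => (isOpen_discrete _).preimage (continuous_apply l)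

theorem zeroIn_mono (n : ℕ) : Monotone (zeroIn n) := fun _ _ hab _ ⟨l, hl, hz⟩ =>
  ⟨l, ⟨hl.1, hl.2.trans hab⟩, hz⟩

theorem exists_mem_zeroIn {z : ℕ → Bool} (hz : ∃ᶠ n in atTop, z n = false) (n : ℕ) :
    ∃ m, z ∈ zeroIn n m := by
  obtain ⟨m, hm, hzm⟩ := frequently_atTop.1 hz n
  exact ⟨m, m, ⟨hm, le_rfl⟩, hzm⟩

theorem theorem2p1 (h : dominatingNumber ≤ reapingNumber) :
    (∃ (X : Type) (_ : TopologicalSpace X),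
      IsSetOfReals X ∧ IsMenger X ∧ ¬ IsScheepers X) ∧
    (∃ (X Y : Type) (_ : TopologicalSpace X) (_ : TopologicalSpace Y),
      IsSetOfReals X ∧ IsSetOfReals Y ∧ IsMenger X ∧ IsMenger Y ∧ ¬ IsMenger (X × Y)) := by
  obtain ⟨d, hd, hdom⟩ := exists_dominating_enumeration
  choose x y hx hy hxy using fun i => exists_avoiding_pair h (mk_Iic_lt_dominatingNumber i)
    (d := fun j => d j) (fun j => hd j) (hd i)
  have hx' : ∀ i, ∀ j ≤ i, ∃ᶠ n in atTop, ∀ l ∈ Set.Icc n (d j n), x i l = false :=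
    fun i j hij => hx i ⟨j, hij⟩
  have hy' : ∀ i, ∀ j ≤ i, ∃ᶠ n in atTop, ∀ l ∈ Set.Icc n (d j n), y i l = false :=
    fun i j hij => hy i ⟨j, hij⟩
  have hX := mengerOn_finitePoints_union_range hdom hx'
  have hY := mengerOn_finitePoints_union_range hdom hy'
  set X := finitePoints ∪ Set.range x
  set Y := finitePoints ∪ Set.range y
  have freqX : ∀ z ∈ X, ∃ᶠ n in atTop, z n = false := by
    rintro z (hz | ⟨i, rfl⟩)
    · exact frequently_false_of_mem_finitePoints hz
    -- Only the left end point `n` of the interval is used.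
    · exact (hx' i i le_rfl).mono fun n hn => hn n ⟨le_rfl, (hd i).le_apply⟩
  have freqY : ∀ z ∈ Y, ∃ᶠ n in atTop, z n = false := by
    rintro z (hz | ⟨i, rfl⟩)
    · exact frequently_false_of_mem_finitePoints hz
    · exact (hy' i i le_rfl).mono fun n hn => hn n ⟨le_rfl, (hd i).le_apply⟩
  have separated : ∀ f : ℕ → ℕ, ∃ i, ∀ᶠ n in atTop,
      ¬ (x i ∈ zeroIn n (f n) ∧ y i ∈ zeroIn n (f n)) := by
    intro f
    obtain ⟨i, hi⟩ := hdom f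
    refine ⟨i, hi.mono ?_⟩
    rintro n hn ⟨⟨k, hk, hxk⟩, l, hl, hyl⟩
    rcases hxy i n with hall | hall
    · simp [hall k ⟨hk.1, hk.2.trans hn⟩] at hxk
    · simp [hall l ⟨hl.1, hl.2.trans hn⟩] at hyl
  refine ⟨⟨↥(X ∪ Y), inferInstance, isSetOfReals_coe _, (hX.union hY).isMenger, fun hS => ?_⟩,
    ⟨X, Y, inferInstance, inferInstance, isSetOfReals_coe _, isSetOfReals_coe _, hX.isMenger,
      hY.isMenger, fun hM => ?_⟩⟩
  · obtain ⟨f, hf⟩ := hS.exists_frequently_subset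
      (W := fun n m => ((↑) : ↥(X ∪ Y) → ℕ → Bool) ⁻¹' zeroIn n m)
      (fun n m => (isOpen_zeroIn n m).preimage continuous_subtype_val)
      (fun n _ _ hab => preimage_mono (zeroIn_mono n hab))
      (fun n z => exists_mem_zeroIn (z.2.elim (freqX _) (freqY _)) n)
    obtain ⟨i, hi⟩ := separated f
    obtain ⟨n, hsub, hnot⟩ := ((hf
      {⟨x i, Or.inl (Or.inr ⟨i, rfl⟩)⟩, ⟨y i, Or.inr (Or.inr ⟨i, rfl⟩)⟩} (Set.toFinite _)).and_eventually hi).exists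
    exact hnot ⟨hsub (Or.inl rfl), hsub (Or.inr rfl)⟩
  · obtain ⟨f, hf⟩ := hM.exists_frequently_mem
      (W := fun n m => (fun p : X × Y => (p.1 : ℕ → Bool)) ⁻¹' zeroIn n m ∩
        (fun p : X × Y => (p.2 : ℕ → Bool)) ⁻¹' zeroIn n m)
      (fun n m => ((isOpen_zeroIn n m).preimage (continuous_subtype_val.comp continuous_fst)).inter
        ((isOpen_zeroIn n m).preimage (continuous_subtype_val.comp continuous_snd)))
      (fun n _ _ hab => inter_subset_inter (preimage_mono (zeroIn_mono n hab))
        (preimage_mono (zeroIn_mono n hab)))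
      (fun n p => by
        obtain ⟨a, ha⟩ := exists_mem_zeroIn (freqX _ p.1.2) n
        obtain ⟨b, hb⟩ := exists_mem_zeroIn (freqY _ p.2.2) n
        exact ⟨max a b, zeroIn_mono n (le_max_left a b) ha, zeroIn_mono n (le_max_right a b) hb⟩)
    obtain ⟨i, hi⟩ := separated f
    obtain ⟨n, hmem, hnot⟩ := ((hf (⟨x i, Or.inr ⟨i, rfl⟩⟩, ⟨y i, Or.inr ⟨i, rfl⟩⟩)).and_eventually
      hi).exists
    exact hnot hmem
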